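/- Let $L$ be an even positive integer, $\beta = L^2$, and $1 \le m \le M$. Let $\mu$ be Haar probability measure on the unit circle $\mathbb T$, and consider the circular $\beta$-ensemble of $M$ particles, with joint density with respect to $\mu^M$ $$f(\mathbf x) = \frac{1}{M!\,Z}\prod_{1\le j<k\le M}|x_k-x_j|^{\beta},\qquad Z = \frac{1}{M!}\int_{\mathbb T^M}\prod_{j<k}|x_k-x_j|^{\beta}\,d\mu^M(\mathbf x).$$ Let $$R_m(\mathbf y) = \frac{M!}{(M-m)!}\int_{\mathbb T^{M-m}} f(y_1,\dots,y_m,x_1,\dots,x_{M-m})\,d\mu^{M-m}(\mathbf x),\qquad \mathbf y\in\mathbb T^m.$$ Put $N' = L(M-m)$ and let $\mathbf e_0,\dots,\mathbf e_{N'-1}$ be the standard basis of $V'=\mathbb C^{N'}$. For an $L$-element subset $\mathfrak u=\{\mathfrak u(1)<\dots<\mathfrak u(L)\}$ of $\{0,\dots,N'-1\}$ let $\mathbf e_{\mathfrak u}=\mathbf e_{\mathfrak u(1)}\wedge\dots\wedge\mathbf e_{\mathfrak u(L)}$, $$\widetilde\Delta\mathfrak u = \prod_{1\le j<k\le L}\frac{\mathfrak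 u(k)-\mathfrak u(j)}{k-j},\qquad \delta\mathfrak u = \sum_{k=1}^L\mathfrak u(k) - \frac{L(N'-1)}2,$$ and for $j\in\mathbb Z$ let $\epsilon^j = \sum_{\delta\mathfrak u=j}\widetilde\Delta\mathfrak u\;\mathbf e_{\mathfrak u}\in\Lambda^L V'$. For $\mathbf y\in\mathbb T^m$ let $b_j(\mathbf y)$, $|j|\le\beta m/2$, be the coefficients of the Laurent polynomial $$f_{\mathbf y}^{\beta}(x) = x^{-\beta m/2}\prod_{n=1}^m (x-y_n)^{\beta} = \sum_{j=-\beta m/2}^{\beta m/2} b_j(\mathbf y)\,x^j,\qquad\text{and put}\qquad f_{\mathbf y}^{\beta}(\epsilon) = \sum_{j=-\beta m/2}^{\beta m/2} b_j(\mathbf y)\,\epsilon^j .$$ For $\omega\in\Lambda^L V'$ let the hyperpfaffian $\mathrm{PF}\,\omega$ be the coefficient of $\mathbf e_0\wedge\dots\wedge\mathbf e_{N'-1}$ in $\omega^{\wedge(M-m)}/(M-m)!$. Then $R_m$ is an $m$th correlation function of the ensemble, that is, $R_m$ is non-negative and measurable, and for all pairwise disjoint Borel sets $B_1,\dots,B_m\subset\mathbb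 T$, with $N_B$ the number of particles in $B$, $$\mathbb E[N_{B_1}\cdots N_{B_m}] = \int_{B_1}\cdots\int_{B_m} R_m\,d\mu^m ;$$ and for every $\mathbf y\in\mathbb T^m$ $$R_m(\mathbf y) = M!\,\binom{\beta M/2}{\beta/2,\dots,\beta/2}^{-1}\prod_{1\le j<k\le m}|y_k-y_j|^{\beta}\cdot\prod_{n=1}^m y_n^{-\beta(M-m)/2}\cdot\mathrm{PF}\,f_{\mathbf y}^{\beta}(\epsilon).$$ -/

import Mathlib

noncomputable section

namespace CircularEnsemble

open MeasureTheory

/-! ### The circular ensemble and its correlation functions -/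

/-- The unit circle carries its Borel σ-algebra. -/
instance instMeasurableSpaceCircle : MeasurableSpace Circle := borel Circle

instance instBorelSpaceCircle : BorelSpace Circle := ⟨rfl⟩

/-- Haar probability measure on the unit circle. -/
def haarCircle : Measure Circle := Measure.haarMeasure ⊤

/-- The product `μ^M` of `M` copies of Haar probability measure. -/
def haarTorus (M : ℕ) : Measure (Fin M → Circle) := Measure.pi fun _ => haarCircle

/-- The product `∏_{j < k} |x_k - x_j|^β`. -/
def absVandermonde (β : ℕ) {M : ℕ} (x : Fin M → Circle) : ℝ :=
  ∏ j : Fin M, ∏ k ∈ Finset.Ioi j, ‖(x k : ℂ) - (x j : ℂ)‖ ^ β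

/-- The partition function `Z = (1 / M!) ∫ ∏_{j < k} |x_k - x_j|^β dμ^M`. -/
def partitionFunction (β M : ℕ) : ℝ :=
  (1 / (M.factorial : ℝ)) * ∫ x, absVandermonde β x ∂(haarTorus M)

/-- The joint density `f = (1 / (M! Z)) ∏_{j < k} |x_k - x_j|^β`. -/
def jointDensity (β : ℕ) {M : ℕ} (x : Fin M → Circle) : ℝ :=
  (1 / ((M.factorial : ℝ) * partitionFunction β M)) * absVandermonde β x

/-- The joint law of the `M` particles of the circular `β`-ensemble. -/
def law (β M : ℕ) : Measure (Fin M → Circle) :=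
  (haarTorus M).withDensity fun x => ENNReal.ofReal (jointDensity β x)

/-- The occupation number `N_B(x)`: how many coordinates of `x` lie in `B`. -/
def occupation {M : ℕ} (B : Set Circle) (x : Fin M → Circle) : ℕ :=
  {i : Fin M | x i ∈ B}.ncard

/-- `R` is an `m`-th correlation function of the point process with joint law `P`:
`E[N_{B_1} ⋯ N_{B_m}] = ∫_{B_1} ⋯ ∫_{B_m} R dμ^m` for all pairwise disjoint `B_1, …, B_m`. -/
structure IsCorrelationFunction {M : ℕ} (P : Measure (Fin M → Circle)) (m : ℕ)
    (R : (Fin m → Circle) → ℝ) : Prop where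
  nonneg : ∀ y, 0 ≤ R y
  measurable : Measurable R
  expectation_eq : ∀ B : Fin m → Set Circle, (∀ i, MeasurableSet (B i)) →
    Pairwise (fun i j => Disjoint (B i) (B j)) →
    ∫⁻ x, ∏ i, (occupation (B i) x : ENNReal) ∂P =
      ∫⁻ y in Set.univ.pi B, ENNReal.ofReal (R y) ∂(haarTorus m)

/-- The configuration `(y_1, …, y_m, x_1, …, x_{M - m})`. -/
def concat {m M : ℕ} (h : m ≤ M) (y : Fin m → Circle) (x : Fin (M - m) → Circle) :
    Fin M → Circle :=
  fun i => Fin.append y x (Fin.cast (Nat.add_sub_of_le h).symm i)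

/-- The `m`-th correlation function of the circular `β`-ensemble, at every point `y`:
`R_m(y) = M! / (M - m)! ∫ f(y_1, …, y_m, x_1, …, x_{M - m}) dμ^{M - m}(x)`. -/
def correlation (β : ℕ) {m M : ℕ} (h : m ≤ M) (y : Fin m → Circle) : ℝ :=
  ((M.factorial : ℝ) / ((M - m).factorial : ℝ)) *
    ∫ x, jointDensity β (concat h y x) ∂(haarTorus (M - m))

/-! ### Hyperpfaffians -/

/-- The exterior algebra of `V = ℂ^N` with basis `e_0, …, e_{N-1}`. -/
abbrev Ext (N : ℕ) : Type := ExteriorAlgebra ℂ (Fin N → ℂ)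

/-- The multivector `e_t = e_{t(0)} ∧ ⋯ ∧ e_{t(n-1)}`. -/
def basisVector {N n : ℕ} (t : Fin n → Fin N) : Ext N :=
  ExteriorAlgebra.ιMulti ℂ n fun k => Pi.single (t k) (1 : ℂ)

/-- The Hodge star on the top degree: the coefficient of `e_0 ∧ ⋯ ∧ e_{N-1}` in a multivector.
It is the linear functional given by the determinant in degree `N` and by `0` in the others. -/
def volumeCoeff (N : ℕ) : Ext N →ₗ[ℂ] ℂ :=
  ExteriorAlgebra.liftAlternating (Pi.single N Matrix.detRowAlternating)

/-- The hyperpfaffian `PF ω = * (ω^{∧ K} / K!)` of an `L`-vector over `ℂ^{L K}`. -/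
def hyperpfaffian (L K : ℕ) (ω : Ext (L * K)) : ℂ :=
  volumeCoeff (L * K) ((K.factorial : ℂ)⁻¹ • ω ^ K)

/-! ### The `L`-vectors of the circular ensemble -/

/-- `Δ̃ 𝔲 = ∏_{j < k} (𝔲(k) - 𝔲(j)) / (k - j)`. -/
def normVandermonde {N L : ℕ} (u : Fin L → Fin N) : ℂ :=
  ∏ j : Fin L, ∏ k ∈ Finset.Ioi j,
    (((u k : ℕ) : ℂ) - ((u j : ℕ) : ℂ)) / (((k : ℕ) : ℂ) - ((j : ℕ) : ℂ))

/-- `δ 𝔲 = Σ 𝔲 - L (N - 1) / 2`. -/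
def excess {N L : ℕ} (u : Fin L → Fin N) : ℚ :=
  (∑ k, ((u k : ℕ) : ℚ)) - (L : ℚ) * ((N : ℚ) - 1) / 2

open Classical in
/-- `ε^j = ∑_{δ 𝔲 = j} Δ̃ 𝔲 e_𝔲`. The sum is over the `L`-element subsets `𝔲` of
`{0, …, N - 1}`, written as strictly increasing maps. -/
def epsilon (N L : ℕ) (j : ℤ) : Ext N :=
  ∑ u : Fin L → Fin N with StrictMono u ∧ excess u = (j : ℚ),
    normVandermonde u • basisVector u

/-- The Laurent polynomial `f_y^β(x) = x^{-β m / 2} ∏_n (x - y_n)^β`, for even `β`. -/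
def fPow (β : ℕ) {m : ℕ} (y : Fin m → Circle) : LaurentPolynomial ℂ :=
  LaurentPolynomial.T (-((β / 2 * m : ℕ) : ℤ)) *
    ∏ n, (LaurentPolynomial.T 1 - LaurentPolynomial.C (y n : ℂ)) ^ β

/-- `f_y^β(ε) = ∑_{j = -β m / 2}^{β m / 2} b_j(y) ε^j`, where `b_j(y)` is the coefficient of `x^j`
in `f_y^β(x)`, for even `β`. -/
def fPowEpsilon (β N L : ℕ) {m : ℕ} (y : Fin m → Circle) : Ext N :=
  ∑ j ∈ Finset.Icc (-((β / 2 * m : ℕ) : ℤ)) ((β / 2 * m : ℕ) : ℤ),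
    (fPow β y).coeff j • epsilon N L j

end CircularEnsemble

end

/-!
On the torus `∏_{j < k} |x_k - x_j|^β` is, up to a monomial, the power `L²` of the Vandermonde
determinant, hence a confluent Vandermonde determinant with a block of `L` rows per particle. It is
therefore the top coefficient of a wedge product of `L`-vectors, one for each particle. Integrating
over the free particles, Fubini's theorem for multilinear maps turns the product into a power of the
single integrated `L`-vector, in which the coefficient of `e_𝔲` is a Fourier coefficient of `f_y^β`
times `Δ̃ 𝔲`; this `L`-vector is `f_y^β(ε)`.

The normalisation is Dyson's constant term identity. Good's recursion for it is Lagrange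
interpolation of the constant `1`, evaluated at `0`.

The correlation property expands `N_{B_1} ⋯ N_{B_m}` over injections of the `m` indices into the
particles. By symmetry of the density all `M! / (M - m)!` of them contribute equally.
-/

noncomputable section

namespace CircularEnsemble

open MeasureTheory

/-! ### Fourier coefficients on the circle -/

instance : Measure.IsHaarMeasure haarCircle := by unfold haarCircle; infer_instance

instance : IsProbabilityMeasure haarCircle :=
  ⟨by rw [haarCircle, ← TopologicalSpace.PositiveCompacts.coe_top]; exact Measure.haarMeasure_self⟩

instance (M : ℕ) : IsProbabilityMeasure (haarTorus M) := by unfold haarTorus; infer_instance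

theorem integrable_of_continuous {X E : Type*} [TopologicalSpace X] [CompactSpace X]
    [MeasurableSpace X] [OpensMeasurableSpace X] [NormedAddCommGroup E] {μ : Measure X}
    [IsFiniteMeasureOnCompacts μ] {f : X → E} (hf : Continuous f) : Integrable f μ :=
  hf.integrable_of_hasCompactSupport (.of_compactSpace f)

theorem continuous_coe_zpow (n : ℤ) : Continuous fun z : Circle => (z : ℂ) ^ n :=
  continuous_subtype_val.zpow₀ n fun z => .inl (Circle.coe_ne_zero z)

theorem integral_zpow_haarCircle (n : ℤ) :
    ∫ z : Circle, (z : ℂ) ^ n ∂haarCircle = if n = 0 then 1 else 0 := by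
  split_ifs with hn
  · simp [hn]
  · have rotation_zpow : (Circle.exp (Real.pi / n) : ℂ) ^ n = -1 := by
      rw [← Circle.coe_zpow, ← Circle.exp_zsmul, zsmul_eq_mul,
        mul_div_cancel₀ _ (by exact_mod_cast hn), Circle.coe_exp, Complex.exp_pi_mul_I]
    refine integral_eq_zero_of_mul_left_eq_neg (g := Circle.exp (Real.pi / n)) fun z => ?_
    rw [Circle.coe_mul, mul_zpow, rotation_zpow, neg_one_mul]

/-- The value of a Laurent polynomial at a point of the circle. -/
def laurentEval (z : Circle) : LaurentPolynomial ℂ →+* ℂ :=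
  LaurentPolynomial.eval₂ (RingHom.id ℂ) (Circle.toUnits z)

@[simp]
theorem laurentEval_T (z : Circle) (n : ℤ) :
    laurentEval z (LaurentPolynomial.T n) = (z : ℂ) ^ n := by
  simp [laurentEval]

@[simp]
theorem laurentEval_C (z : Circle) (a : ℂ) : laurentEval z (LaurentPolynomial.C a) = a := by
  simp [laurentEval]

theorem continuous_laurentEval (p : LaurentPolynomial ℂ) :
    Continuous fun z => laurentEval z p := by
  induction p using LaurentPolynomial.induction_on' with
  | add p q hp hq => simp_rw [map_add]; exact hp.add hq
  | C_mul_T n a => simpa using (continuous_coe_zpow n).const_mul a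

theorem integral_laurentEval (p : LaurentPolynomial ℂ) :
    ∫ z, laurentEval z p ∂haarCircle = p.coeff 0 := by
  induction p using LaurentPolynomial.induction_on' with
  | add p q hp hq =>
    simp only [map_add]
    rw [integral_add (integrable_of_continuous (continuous_laurentEval p))
      (integrable_of_continuous (continuous_laurentEval q)), hp, hq, AddMonoidAlgebra.coeff_add,
      Finsupp.add_apply]
  | C_mul_T n a =>
    simp_rw [map_mul, laurentEval_C, laurentEval_T]
    rw [integral_const_mul, integral_zpow_haarCircle, ← LaurentPolynomial.smul_eq_C_mul]
    simp

theorem coeff_T_mul (p : LaurentPolynomial ℂ) (n j : ℤ) :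
    (LaurentPolynomial.T n * p).coeff j = p.coeff (j - n) := by
  rw [LaurentPolynomial.T, AddMonoidAlgebra.coeff_single_mul_apply]
  simp [sub_eq_neg_add]

theorem integral_zpow_mul_laurentEval (p : LaurentPolynomial ℂ) (j : ℤ) :
    ∫ z : Circle, (z : ℂ) ^ (-j) * laurentEval z p ∂haarCircle = p.coeff j := by
  have h := integral_laurentEval (LaurentPolynomial.T (-j) * p)
  simp_rw [map_mul, laurentEval_T] at h
  rw [h, coeff_T_mul, zero_sub, neg_neg]

theorem integral_eval_haarCircle (p : Polynomial ℂ) :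
    ∫ z : Circle, p.eval (z : ℂ) ∂haarCircle = p.eval 0 := by
  have coeff_zero : (Polynomial.toLaurent p).coeff 0 = p.coeff 0 := by
    rw [LaurentPolynomial.coeff_toLaurent]
    exact Finsupp.mapDomain_apply Nat.castEmbedding.injective _ 0
  rw [← Polynomial.coeff_zero_eq_eval_zero, ← coeff_zero, ← integral_laurentEval]
  simp [laurentEval]

theorem integral_eval_inv_haarCircle (p : Polynomial ℂ) :
    ∫ z : Circle, p.eval (z : ℂ)⁻¹ ∂haarCircle = p.eval 0 := by
  simpa only [Circle.coe_inv, integral_eval_haarCircle] using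
    integral_inv_eq_self (fun z : Circle => p.eval (z : ℂ)) haarCircle

/-! ### Dyson's constant term identity -/

theorem sum_add_one_mul_multinomial {ι : Type*} [DecidableEq ι] {s : Finset ι} {k : ι}
    (hk : k ∈ s) (a : ι → ℕ) :
    (∑ i ∈ s, a i + 1) * Nat.multinomial s a =
      (a k + 1) * Nat.multinomial s (Function.update a k (a k + 1)) := by
  have sum_update : ∑ i ∈ s, Function.update a k (a k + 1) i = ∑ i ∈ s, a i + 1 := by
    rw [Finset.sum_update_of_mem hk, Finset.sum_eq_add_sum_sdiff_singleton_of_mem hk a]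
    ring
  have prod_factorial : ∏ i ∈ s, (Function.update a k (a k + 1) i).factorial =
      (a k + 1) * ∏ i ∈ s, (a i).factorial := by
    simp_rw [Function.apply_update (fun _ => Nat.factorial)]
    rw [Finset.prod_update_of_mem hk, Nat.factorial_succ, mul_assoc,
      Finset.prod_eq_mul_prod_sdiff_singleton_of_mem hk fun i => (a i).factorial]
  refine Nat.eq_of_mul_eq_mul_left (Finset.prod_pos fun i _ => (a i).factorial_pos :
    0 < ∏ i ∈ s, (a i).factorial) ?_
  calc (∏ i ∈ s, (a i).factorial) * ((∑ i ∈ s, a i + 1) * Nat.multinomial s a)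
      = (∑ i ∈ s, a i + 1).factorial := by
        rw [mul_left_comm, Nat.multinomial_spec, Nat.factorial_succ]
    _ = (∏ i ∈ s, (a i).factorial) *
          ((a k + 1) * Nat.multinomial s (Function.update a k (a k + 1))) := by
        rw [← sum_update, ← Nat.multinomial_spec, prod_factorial]
        ring

section Dyson

variable {ι F : Type*} [Fintype ι] [DecidableEq ι] [Field F]

/-- The Laurent polynomial `∏_{i ≠ j} (1 - x_i / x_j)^{a_i}`, whose constant term Dyson conjectured
to be the multinomial coefficient of `a`. -/
def dysonProd (a : ι → ℕ) (x : ι → F) : F :=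
  ∏ i, ∏ j ∈ {i}ᶜ, (1 - x i / x j) ^ a i

theorem dysonProd_eq_zero {a : ι → ℕ} {x : ι → F} {i j : ι} (hij : i ≠ j) (hx : x i = x j)
    (hj : x j ≠ 0) (ha : a i ≠ 0) : dysonProd a x = 0 :=
  Finset.prod_eq_zero (Finset.mem_univ i) <|
    Finset.prod_eq_zero (i := j) (by simpa using hij.symm) (by simp [hx, hj, ha])

theorem dysonProd_eq_dysonProd_update_mul {a : ι → ℕ} (x : ι → F) {k : ι} (hk : 0 < a k) :
    dysonProd a x = dysonProd (Function.update a k (a k - 1)) x * ∏ j ∈ {k}ᶜ, (1 - x k / x j) := by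
  have factor_of_ne : ∀ i ∈ ({k}ᶜ : Finset ι), ∏ j ∈ {i}ᶜ, (1 - x i / x j) ^ a i =
      ∏ j ∈ {i}ᶜ, (1 - x i / x j) ^ Function.update a k (a k - 1) i := fun i hi => by
    rw [Function.update_of_ne (by simpa only [Finset.mem_compl, Finset.mem_singleton] using hi)]
  rw [dysonProd, dysonProd, Fintype.prod_eq_mul_prod_compl k,
    Fintype.prod_eq_mul_prod_compl k fun i => ∏ j ∈ {i}ᶜ, _, Finset.prod_congr rfl factor_of_ne,
    Function.update_self, mul_right_comm]
  congr 1
  rw [← Finset.prod_mul_distrib]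
  simp_rw [← pow_succ, Nat.sub_add_cancel hk]

/-- Lagrange interpolation of the constant polynomial `1` at the nodes `x`, evaluated at `0`. -/
theorem sum_prod_one_sub_div_inv [Nonempty ι] {x : ι → F} (hx : Function.Injective x)
    (hx0 : ∀ i, x i ≠ 0) : ∑ k, (∏ j ∈ {k}ᶜ, (1 - x k / x j))⁻¹ = 1 := by
  have h := congrArg (Polynomial.eval 0)
    (Lagrange.sum_basis (s := Finset.univ) (v := x) hx.injOn Finset.univ_nonempty)
  rw [Polynomial.eval_finsetSum, Polynomial.eval_one] at h
  refine (Finset.sum_congr rfl fun k _ => ?_).trans h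
  rw [Lagrange.basis, Polynomial.eval_prod, ← Finset.prod_inv_distrib, ← Finset.compl_singleton]
  refine Finset.prod_congr rfl fun j hj => ?_
  have hjk : x k - x j ≠ 0 := sub_ne_zero.2 (hx.ne (by simpa [eq_comm] using hj))
  have hkj : x j - x k ≠ 0 := sub_ne_zero.2 (hx.ne (by simpa using hj))
  rw [one_sub_div (hx0 j), Lagrange.basisDivisor]
  simp only [Polynomial.eval_mul, Polynomial.eval_C, Polynomial.eval_sub, Polynomial.eval_X]
  field_simp
  ring

theorem dysonProd_eq_sum [Nonempty ι] {a : ι → ℕ} (ha : ∀ i, 0 < a i) {x : ι → F}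
    (hx0 : ∀ i, x i ≠ 0) :
    dysonProd a x = ∑ k, dysonProd (Function.update a k (a k - 1)) x := by
  by_cases hx : Function.Injective x
  · rw [← mul_one (dysonProd a x), ← sum_prod_one_sub_div_inv hx hx0, Finset.mul_sum]
    refine Finset.sum_congr rfl fun k _ => ?_
    have hk : ∏ j ∈ {k}ᶜ, (1 - x k / x j) ≠ 0 := Finset.prod_ne_zero_iff.2 fun j hj => by
      rw [one_sub_div (hx0 j)]
      exact div_ne_zero (sub_ne_zero.2 (hx.ne (by simpa using hj))) (hx0 j)
    rw [dysonProd_eq_dysonProd_update_mul x (ha k), mul_inv_cancel_right₀ hk]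
  · obtain ⟨i, j, hxij, hij⟩ := Function.not_injective_iff.1 hx
    rw [dysonProd_eq_zero hij hxij (hx0 j) (ha i).ne', Finset.sum_eq_zero]
    intro k _
    rcases ne_or_eq i k with hik | rfl
    · exact dysonProd_eq_zero hij hxij (hx0 j) (by simp [hik, (ha i).ne'])
    · exact dysonProd_eq_zero hij.symm hxij.symm (hx0 i) (by simp [hij.symm, (ha j).ne'])

theorem multinomial_univ_eq_sum [Nonempty ι] {a : ι → ℕ} (ha : ∀ i, 0 < a i) :
    Nat.multinomial Finset.univ a =
      ∑ k, Nat.multinomial Finset.univ (Function.update a k (a k - 1)) := by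
  refine Nat.eq_of_mul_eq_mul_left
    (Finset.sum_pos (fun i _ => ha i) Finset.univ_nonempty : 0 < ∑ i, a i) ?_
  rw [Finset.mul_sum, Finset.sum_mul]
  refine Finset.sum_congr rfl fun k _ => ?_
  have sum_pred : ∑ i, Function.update a k (a k - 1) i + 1 = ∑ i, a i := by
    rw [Finset.sum_update_of_mem (Finset.mem_univ k),
      Finset.sum_eq_add_sum_sdiff_singleton_of_mem (Finset.mem_univ k) a, add_right_comm,
      Nat.sub_add_cancel (ha k)]
  have h := sum_add_one_mul_multinomial (Finset.mem_univ k) (Function.update a k (a k - 1))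
  rw [sum_pred, Function.update_self, Nat.sub_add_cancel (ha k), Function.update_idem,
    Function.update_eq_self] at h
  exact h.symm

end Dyson

open Polynomial in
theorem eval_inv_prod_one_sub_pow {ι F : Type*} [Field F] (s : Finset ι) (y : ι → F) (a : ι → ℕ)
    (z : F) : (∏ j ∈ s, (1 - C (y j) * X) ^ a j).eval z⁻¹ = ∏ j ∈ s, (1 - y j / z) ^ a j := by
  simp [eval_prod, div_eq_mul_inv]

theorem dysonProd_insertNth {F : Type*} [Field F] {n : ℕ} {a : Fin (n + 1) → ℕ} {i : Fin (n + 1)}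
    (hi : a i = 0) (z : F) (y : Fin n → F) :
    dysonProd a (i.insertNth z y) =
      dysonProd (i.removeNth a) y * ∏ j, (1 - y j / z) ^ i.removeNth a j := by
  have compl_eq (k : Fin n) : ({i.succAbove k}ᶜ : Finset (Fin (n + 1))) =
      insert i (({k}ᶜ : Finset (Fin n)).map i.succAboveEmb) := by
    ext j
    cases j using i.succAboveCases <;> simp
  rw [dysonProd, Fin.prod_univ_succAbove _ i, dysonProd, ← Finset.prod_mul_distrib]
  simp [hi, compl_eq, Fin.removeNth, mul_comm]

theorem multinomial_univ_removeNth {n : ℕ} {a : Fin (n + 1) → ℕ} {i : Fin (n + 1)} (hi : a i = 0) :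
    Nat.multinomial Finset.univ (i.removeNth a) = Nat.multinomial Finset.univ a := by
  simp [Nat.multinomial, Fin.sum_univ_succAbove _ i, Fin.prod_univ_succAbove _ i, hi,
    Fin.removeNth]

theorem continuous_dysonProd {ι : Type*} [Fintype ι] [DecidableEq ι] (a : ι → ℕ) :
    Continuous fun x : ι → Circle => dysonProd a fun i => (x i : ℂ) := by
  simp only [dysonProd, div_eq_mul_inv, ← Circle.coe_inv]
  fun_prop

theorem integral_haarTorus_insertNth {E : Type*} [NormedAddCommGroup E] [NormedSpace ℝ E] {n : ℕ}
    (i : Fin (n + 1)) {f : (Fin (n + 1) → Circle) → E} (hf : Continuous f) :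
    ∫ x, f x ∂haarTorus (n + 1) =
      ∫ y, ∫ z, f (i.insertNth z y) ∂haarCircle ∂haarTorus n := by
  have h := (measurePreserving_piFinSuccAbove (fun _ : Fin (n + 1) => haarCircle) i).symm
  rw [haarTorus, ← h.integral_comp' (g := f), integral_prod_symm]
  · rfl
  · exact integrable_of_continuous (hf.comp
      (Continuous.finInsertNth (A := fun _ => Circle) i continuous_fst continuous_snd))

theorem integral_dysonProd_of_eq_zero {n : ℕ} {a : Fin (n + 1) → ℕ} {i : Fin (n + 1)}
    (hi : a i = 0) :
    ∫ x, dysonProd a (fun j => (x j : ℂ)) ∂haarTorus (n + 1) =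
      ∫ y, dysonProd (i.removeNth a) (fun j => (y j : ℂ)) ∂haarTorus n := by
  rw [integral_haarTorus_insertNth i (continuous_dysonProd a)]
  refine integral_congr_ae (ae_of_all _ fun y => ?_)
  have coe_insertNth (z : Circle) : (fun j => ((i.insertNth z y : Fin (n + 1) → Circle) j : ℂ)) =
      i.insertNth (z : ℂ) fun j => (y j : ℂ) := by
    ext j
    cases j using i.succAboveCases <;> simp
  simp_rw [coe_insertNth, dysonProd_insertNth hi, ← eval_inv_prod_one_sub_pow,
    integral_const_mul, integral_eval_inv_haarCircle]
  simp [Polynomial.eval_prod]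

theorem integral_dysonProd_eq_sum {ι : Type*} [Fintype ι] [DecidableEq ι] [Nonempty ι] {a : ι → ℕ}
    (ha : ∀ i, 0 < a i) (μ : Measure (ι → Circle)) [IsFiniteMeasureOnCompacts μ] :
    ∫ x, dysonProd a (fun i => (x i : ℂ)) ∂μ =
      ∑ k, ∫ x, dysonProd (Function.update a k (a k - 1)) (fun i => (x i : ℂ)) ∂μ := by
  simp_rw [dysonProd_eq_sum ha fun _ => Circle.coe_ne_zero _]
  exact integral_finsetSum _ fun k _ => integrable_of_continuous (continuous_dysonProd _)

/-- Induction on the exponents: a vanishing exponent removes a variable, and otherwise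
Good's recursion lowers the sum of the exponents. -/
theorem integral_dysonProd {n : ℕ} (a : Fin n → ℕ) :
    ∫ x, dysonProd a (fun i => (x i : ℂ)) ∂haarTorus n = Nat.multinomial Finset.univ a := by
  induction n with
  | zero => simp [dysonProd]
  | succ n ih =>
    induction hS : ∑ i, a i using Nat.strong_induction_on generalizing a with
    | _ S ihS =>
    by_cases! ha : ∀ i, 0 < a i
    · rw [integral_dysonProd_eq_sum ha, multinomial_univ_eq_sum ha, Nat.cast_sum]
      refine Finset.sum_congr rfl fun k _ => ihS _ ?_ _ rfl
      rw [← hS, Finset.sum_update_of_mem (Finset.mem_univ k),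
        Finset.sum_eq_add_sum_sdiff_singleton_of_mem (Finset.mem_univ k) a]
      exact Nat.add_lt_add_right (Nat.sub_one_lt (ha k).ne') _
    · obtain ⟨i, hi⟩ := ha
      rw [Nat.le_zero] at hi
      rw [integral_dysonProd_of_eq_zero hi, ih, multinomial_univ_removeNth hi]

/-! ### Absolute powers of the Vandermonde product -/

theorem normSq_coe_sub_coe (z w : Circle) :
    ((‖(z : ℂ) - w‖ ^ 2 : ℝ) : ℂ) = (1 - (z : ℂ) / w) * (1 - (w : ℂ) / z) := by
  have hz := Circle.coe_ne_zero z
  have hw := Circle.coe_ne_zero w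
  rw [Complex.ofReal_pow, ← Complex.mul_conj', map_sub, ← Circle.coe_inv_eq_conj,
    ← Circle.coe_inv_eq_conj, Circle.coe_inv, Circle.coe_inv]
  field_simp

theorem norm_coe_sub_coe_pow {β : ℕ} (hβ : 4 ∣ β) (z w : Circle) :
    ((‖(z : ℂ) - w‖ ^ β : ℝ) : ℂ) =
      ((z : ℂ) - w) ^ β * ((z : ℂ) ^ (β / 2))⁻¹ * ((w : ℂ) ^ (β / 2))⁻¹ := by
  obtain ⟨k, rfl⟩ := hβ
  have hz := Circle.coe_ne_zero z
  have hw := Circle.coe_ne_zero w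
  have half : 4 * k / 2 = 2 * k := by omega
  have factor : (1 - (z : ℂ) / w) * (1 - (w : ℂ) / z) =
      -(((z : ℂ) - w) ^ 2 * (z : ℂ)⁻¹ * (w : ℂ)⁻¹) := by
    field_simp
    ring
  rw [half, show 4 * k = 2 * (2 * k) by ring, pow_mul, Complex.ofReal_pow, normSq_coe_sub_coe,
    factor, (even_two_mul k).neg_pow, mul_pow, mul_pow, inv_pow, inv_pow, ← pow_mul]

section absVandermonde

variable (β : ℕ) {M : ℕ}

theorem continuous_absVandermonde : Continuous fun x : Fin M → Circle => absVandermonde β x := by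
  unfold absVandermonde
  fun_prop

theorem absVandermonde_nonneg (x : Fin M → Circle) : 0 ≤ absVandermonde β x :=
  Finset.prod_nonneg fun _ _ => Finset.prod_nonneg fun _ _ => by positivity

theorem absVandermonde_eq_norm_det_pow (x : Fin M → Circle) :
    absVandermonde β x = ‖(Matrix.vandermonde fun i => (x i : ℂ)).det‖ ^ β := by
  simp only [absVandermonde, Matrix.det_vandermonde, norm_prod, Finset.prod_pow]

theorem absVandermonde_comp_perm (x : Fin M → Circle) (σ : Equiv.Perm (Fin M)) :
    absVandermonde β (x ∘ σ) = absVandermonde β x := by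
  have norm_det : ‖(Matrix.vandermonde fun i => ((x ∘ σ) i : ℂ)).det‖ =
      ‖(Matrix.vandermonde fun i => (x i : ℂ)).det‖ := by
    rw [show (Matrix.vandermonde fun i => ((x ∘ σ) i : ℂ)) =
      (Matrix.vandermonde fun i => (x i : ℂ)).submatrix σ id from rfl, Matrix.det_permute,
      norm_mul, Complex.norm_intCast, abs_unit_intCast, one_mul]
  rw [absVandermonde_eq_norm_det_pow, absVandermonde_eq_norm_det_pow, norm_det]

theorem absVandermonde_inv (x : Fin M → Circle) : absVandermonde β x⁻¹ = absVandermonde β x := by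
  have norm_inv_sub_inv (z w : Circle) :
      ‖((z⁻¹ : Circle) : ℂ) - (w⁻¹ : Circle)‖ = ‖(z : ℂ) - w‖ := by
    rw [Circle.coe_inv_eq_conj, Circle.coe_inv_eq_conj, ← map_sub, Complex.norm_conj]
  simp only [absVandermonde, Pi.inv_apply, norm_inv_sub_inv]

theorem absVandermonde_append {m K : ℕ} (y : Fin m → Circle) (x : Fin K → Circle) :
    absVandermonde β (Fin.append y x) = absVandermonde β y * absVandermonde β x *
      ∏ i, ∏ n, ‖(x i : ℂ) - y n‖ ^ β := by
  have castAdd_lt (n : Fin m) (i : Fin K) : Fin.castAdd K n < Fin.natAdd m i :=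
    Nat.lt_add_right i n.2
  rw [Finset.prod_comm]
  simp only [absVandermonde, ← Finset.filter_lt_eq_Ioi, Finset.prod_filter, Fin.prod_univ_add,
    Fin.append_left, Fin.append_right, castAdd_lt, (castAdd_lt _ _).not_gt, if_true, if_false,
    Fin.natAdd_lt_natAdd_iff, (Fin.strictMono_castAdd K).lt_iff_lt, Finset.prod_mul_distrib,
    Finset.prod_const_one]
  ring

theorem absVandermonde_comp_cast {K : ℕ} (h : K = M) (x : Fin M → Circle) :
    absVandermonde β (x ∘ Fin.cast h) = absVandermonde β x := by
  subst h
  rfl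

theorem absVandermonde_concat {m : ℕ} (h : m ≤ M) (y : Fin m → Circle)
    (x : Fin (M - m) → Circle) :
    absVandermonde β (concat h y x) = absVandermonde β y * absVandermonde β x *
      ∏ i, ∏ n, ‖(x i : ℂ) - y n‖ ^ β :=
  (absVandermonde_comp_cast β _ _).trans (absVandermonde_append β y x)

end absVandermonde

theorem prod_prod_Ioi_mul_eq_prod_zpow {G : Type*} [DivisionCommMonoid G] {K : ℕ} (c : Fin K → G) :
    ∏ i, ∏ j ∈ Finset.Ioi i, (c j * c i) = ∏ i, c i ^ ((K : ℤ) - 1) := by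
  simp_rw [mul_comm (c _) (c _)]
  rw [Finset.prod_prod_Ioi_mul_eq_prod_prod_off_diag fun _ i => c i]
  refine Finset.prod_congr rfl fun i _ => ?_
  rw [Finset.prod_const, Finset.card_compl, Finset.card_singleton, Fintype.card_fin,
    ← Nat.cast_pred i.pos, zpow_natCast]

theorem absVandermonde_eq_dysonProd {β : ℕ} (hβ : Even β) {M : ℕ} (x : Fin M → Circle) :
    (absVandermonde β x : ℂ) = dysonProd (fun _ => β / 2) (fun i => (x i : ℂ)) := by
  have norm_pow (z w : Circle) : ((‖(z : ℂ) - w‖ ^ β : ℝ) : ℂ) =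
      (1 - (w : ℂ) / z) ^ (β / 2) * (1 - (z : ℂ) / w) ^ (β / 2) := by
    rw [mul_comm, ← mul_pow, ← normSq_coe_sub_coe, ← Complex.ofReal_pow, ← pow_mul,
      Nat.mul_div_cancel' hβ.two_dvd]
  simp_rw [absVandermonde, Complex.ofReal_prod, norm_pow]
  exact Finset.prod_prod_Ioi_mul_eq_prod_prod_off_diag
    fun j i => (1 - (x i : ℂ) / x j) ^ (β / 2)

theorem integral_absVandermonde {β : ℕ} (hβ : Even β) (M : ℕ) :
    ∫ x : Fin M → Circle, absVandermonde β x ∂haarTorus M =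
      Nat.multinomial Finset.univ fun _ : Fin M => β / 2 := by
  apply Complex.ofReal_injective
  simp_rw [← integral_complex_ofReal, absVandermonde_eq_dysonProd hβ]
  rw [integral_dysonProd, Complex.ofReal_natCast]

theorem factorial_mul_partitionFunction {β : ℕ} (hβ : Even β) (M : ℕ) :
    (M.factorial : ℝ) * partitionFunction β M =
      Nat.multinomial Finset.univ fun _ : Fin M => β / 2 := by
  rw [partitionFunction, integral_absVandermonde hβ, ← mul_assoc,
    mul_one_div_cancel (by exact_mod_cast Nat.factorial_ne_zero M), one_mul]

theorem absVandermonde_eq_prod_sub_pow {β : ℕ} (hβ : 4 ∣ β) {K : ℕ} (x : Fin K → Circle) :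
    (absVandermonde β x : ℂ) = (∏ i, ∏ j ∈ Finset.Ioi i, ((x j : ℂ) - x i) ^ β) *
      ∏ i, ((x i : ℂ) ^ (β / 2))⁻¹ ^ ((K : ℤ) - 1) := by
  simp_rw [absVandermonde, Complex.ofReal_prod, norm_coe_sub_coe_pow hβ, mul_assoc]
  simp_rw [← prod_prod_Ioi_mul_eq_prod_zpow, ← Finset.prod_mul_distrib]

/-! ### The confluent Vandermonde determinant -/

section ConfluentVandermonde

open Polynomial

variable {R : Type*} [CommRing R]

theorem coeff_taylor_eq_zero_of_X_sub_C_pow_dvd {x : R} {p : R[X]} {n d : ℕ} (hnd : n < d)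
    (hp : (X - C x) ^ d ∣ p) : (taylor x p).coeff n = 0 := by
  obtain ⟨q, rfl⟩ := hp
  rw [taylor_mul, taylor_pow, map_sub, taylor_X, taylor_C, add_sub_cancel_right, coeff_X_pow_mul',
    if_neg hnd.not_ge]

/-- The `l`-th divided derivative at `x` of the moment curve `(1, X, …, X ^ (N - 1))`, that is, a
row of a confluent Vandermonde matrix. -/
def confluentVector (N : ℕ) (x : R) (l : ℕ) : Fin N → R :=
  fun n => ((n : ℕ).choose l : R) * x ^ ((n : ℕ) - l)

theorem sum_confluentVector_mul_coeff {N : ℕ} (x : R) (l : ℕ) {p : R[X]} (hp : p.natDegree < N) :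
    ∑ n : Fin N, confluentVector N x l n * p.coeff n = (taylor x p).coeff l := by
  conv_rhs => rw [p.as_sum_range' N hp, map_sum, finsetSum_coeff,
    ← Fin.sum_univ_eq_sum_range fun n => (taylor x (monomial n (p.coeff n))).coeff l]
  refine Finset.sum_congr rfl fun n _ => ?_
  rw [taylor_monomial, coeff_C_mul, coeff_X_add_C_pow, confluentVector]
  ring

variable {L K : ℕ}

/-- The index of the block of `L` consecutive rows that contains row `q`. -/
def blockIndex (q : Fin (L * K)) : Fin K := ⟨q / L, Nat.div_lt_of_lt_mul q.2⟩

theorem prod_comp_blockIndex {α : Type*} [CommMonoid α] (f : Fin K → α) :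
    ∏ q : Fin (L * K), f (blockIndex q) = ∏ i, f i ^ L := by
  have blockIndex_finProdFinEquiv (i : Fin K) (l : Fin L) :
      blockIndex (finProdFinEquiv.trans (finCongr (Nat.mul_comm K L)) (i, l)) = i := by
    ext
    simp [blockIndex, Nat.add_mul_div_left _ _ l.pos, Nat.div_eq_of_lt l.2]
  rw [← (finProdFinEquiv.trans (finCongr (Nat.mul_comm K L))).prod_comp, Fintype.prod_prod_type]
  simp only [blockIndex_finProdFinEquiv, Finset.prod_const, Finset.card_univ, Fintype.card_fin]

/-- The confluent Vandermonde matrix with `L` rows, the divided derivatives of orders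
`0, …, L - 1`, at each of the `K` nodes. -/
def confluentVandermonde (L : ℕ) (x : Fin K → R) : Matrix (Fin (L * K)) (Fin (L * K)) R :=
  Matrix.of fun q => confluentVector (L * K) (x (blockIndex q)) (q % L)

/-- The Newton basis polynomial `∏_{j < i} (X - x_j) ^ L * (X - x_i) ^ l`, where `q = L * i + l`
with `l < L`. -/
def newtonPolynomial (x : Fin K → R) (q : Fin (L * K)) : R[X] :=
  (∏ j ∈ Finset.Iio (blockIndex q), (X - C (x j)) ^ L) * (X - C (x (blockIndex q))) ^ (q % L : ℕ)

variable (x : Fin K → R)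

theorem monic_newtonPolynomial (q : Fin (L * K)) : (newtonPolynomial x q).Monic :=
  (monic_prod_of_monic _ _ fun j _ => (monic_X_sub_C (x j)).pow L).mul ((monic_X_sub_C _).pow _)

theorem natDegree_newtonPolynomial [Nontrivial R] (q : Fin (L * K)) :
    (newtonPolynomial x q).natDegree = q := by
  have monic_pow (j : Fin K) (n : ℕ) : ((X - C (x j)) ^ n).Monic := (monic_X_sub_C (x j)).pow n
  rw [newtonPolynomial, (monic_prod_of_monic _ _ fun j _ => monic_pow j L).natDegree_mul
    (monic_pow _ _), natDegree_prod_of_monic _ _ fun j _ => monic_pow j L]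
  simp_rw [(monic_X_sub_C _).natDegree_pow, natDegree_X_sub_C, mul_one, Finset.sum_const,
    Fin.card_Iio, smul_eq_mul]
  exact Nat.div_add_mod' _ _

theorem X_sub_C_pow_dvd_newtonPolynomial_of_lt {i : Fin K} {q : Fin (L * K)}
    (h : i < blockIndex q) : (X - C (x i)) ^ L ∣ newtonPolynomial x q :=
  (Finset.dvd_prod_of_mem (fun j => (X - C (x j)) ^ L) (Finset.mem_Iio.2 h)).mul_right _

theorem coeff_taylor_newtonPolynomial_of_lt {q r : Fin (L * K)} (h : q < r) :
    (taylor (x (blockIndex q)) (newtonPolynomial x r)).coeff (q % L) = 0 := by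
  have hL : 0 < L := Nat.pos_of_mul_pos_right q.pos
  have block_le : blockIndex q ≤ blockIndex r := Nat.div_le_div_right h.le
  rcases block_le.lt_or_eq with block_lt | block_eq
  · exact coeff_taylor_eq_zero_of_X_sub_C_pow_dvd (Nat.mod_lt _ hL)
      (X_sub_C_pow_dvd_newtonPolynomial_of_lt x block_lt)
  · have mod_lt : (q : ℕ) % L < r % L := by
      have div_eq : (q : ℕ) / L = r / L := congrArg Fin.val block_eq
      have hq := Nat.div_add_mod (q : ℕ) L
      have hr := Nat.div_add_mod (r : ℕ) L
      rw [div_eq] at hq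
      omega
    exact coeff_taylor_eq_zero_of_X_sub_C_pow_dvd mod_lt (block_eq ▸ Dvd.intro_left _ rfl)

theorem coeff_taylor_newtonPolynomial_self (q : Fin (L * K)) :
    (taylor (x (blockIndex q)) (newtonPolynomial x q)).coeff (q % L) =
      ∏ j ∈ Finset.Iio (blockIndex q), (x (blockIndex q) - x j) ^ L := by
  rw [newtonPolynomial, taylor_mul, taylor_pow, map_sub, taylor_X, taylor_C, add_sub_cancel_right,
    coeff_mul_X_pow', if_pos le_rfl, Nat.sub_self, taylor_coeff_zero, eval_prod]
  simp

theorem confluentVandermonde_mul_newtonPolynomial [Nontrivial R] (q r : Fin (L * K)) :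
    (confluentVandermonde L x *
        Matrix.of fun i j : Fin (L * K) => (newtonPolynomial x j).coeff i) q r =
      (taylor (x (blockIndex q)) (newtonPolynomial x r)).coeff (q % L) :=
  sum_confluentVector_mul_coeff _ _ ((natDegree_newtonPolynomial x r).trans_lt r.2)

theorem det_confluentVandermonde :
    (confluentVandermonde L x).det = ∏ i, ∏ j ∈ Finset.Ioi i, (x j - x i) ^ (L ^ 2) := by
  nontriviality R
  have det_newton :
      (Matrix.of fun i j : Fin (L * K) => (newtonPolynomial x j).coeff i).det = 1 :=
    Matrix.det_matrixOfPolynomials _ (natDegree_newtonPolynomial x) (monic_newtonPolynomial x)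
  rw [← mul_one (Matrix.det _), ← det_newton, ← Matrix.det_mul, Matrix.det_of_isLowerTriangular]
  · simp_rw [confluentVandermonde_mul_newtonPolynomial, coeff_taylor_newtonPolynomial_self]
    rw [prod_comp_blockIndex fun b => ∏ j ∈ Finset.Iio b, (x b - x j) ^ L]
    simp_rw [← Finset.prod_pow, ← pow_mul, ← sq]
    exact Finset.prod_comm' (by simp)
  · intro q r h
    rw [confluentVandermonde_mul_newtonPolynomial]
    exact coeff_taylor_newtonPolynomial_of_lt x h

end ConfluentVandermonde

/-! ### The multivector of a confluent block -/

theorem prod_factorial_mul_det_choose {L : ℕ} (u : Fin L → ℕ) :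
    (∏ l : Fin L, ((l : ℕ).factorial : ℂ)) *
        (Matrix.of fun k l : Fin L => ((u k).choose l : ℂ)).det =
      ∏ j : Fin L, ∏ k ∈ Finset.Ioi j, ((u k : ℂ) - (u j : ℂ)) := by
  rw [← Matrix.det_vandermonde, Matrix.det_eval_matrixOfPolynomials_eq_det_vandermonde _
    (fun i : Fin L => descPochhammer ℂ i) (fun i => descPochhammer_natDegree ℂ i)
    (fun i => monic_descPochhammer ℂ i), ← Matrix.det_mul_row]
  congr 1
  ext k l
  rw [Matrix.of_apply, Matrix.of_apply, Matrix.of_apply, descPochhammer_eval_eq_descFactorial,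
    Nat.descFactorial_eq_factorial_mul_choose, Nat.cast_mul]

theorem det_choose_eq_normVandermonde {N L : ℕ} (u : Fin L → Fin N) :
    (Matrix.of fun k l : Fin L => ((u k : ℕ).choose l : ℂ)).det = normVandermonde u := by
  have det_choose_id : (Matrix.of fun k l : Fin L => ((k : ℕ).choose l : ℂ)).det = 1 := by
    rw [Matrix.det_of_isLowerTriangular]
    · simp
    · intro i j hij
      have : (i : ℕ) < j := hij
      simp [Nat.choose_eq_zero_of_lt this]
  have superfactorial := prod_factorial_mul_det_choose fun k : Fin L => (k : ℕ)
  rw [det_choose_id, mul_one] at superfactorial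
  have superfactorial_ne_zero : (∏ l : Fin L, ((l : ℕ).factorial : ℂ)) ≠ 0 :=
    Finset.prod_ne_zero_iff.2 fun l _ => by exact_mod_cast Nat.factorial_ne_zero _
  simp_rw [normVandermonde, Finset.prod_div_distrib]
  rw [← prod_factorial_mul_det_choose fun k => (u k : ℕ), ← superfactorial,
    mul_div_cancel_left₀ _ superfactorial_ne_zero]

open Classical in
theorem ιMulti_eq_sum_det_smul_basisVector {N L : ℕ} (v : Fin L → Fin N → ℂ) :
    ExteriorAlgebra.ιMulti ℂ L v =
      ∑ u : Fin L → Fin N with StrictMono u,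
        (Matrix.of fun i k => v i (u k)).det • basisVector u := by
  have expansion := congrArg (Submodule.subtype _)
    (((Pi.basisFun ℂ (Fin N)).exteriorPower L).sum_repr (exteriorPower.ιMulti ℂ L v))
  rw [map_sum] at expansion
  simp only [map_smul, Submodule.subtype_apply, exteriorPower.ιMulti_apply_coe] at expansion
  rw [← expansion]
  symm
  refine Finset.sum_bij' (fun u hu => Set.powersetCard.ofFinEmbEquiv
      (OrderEmbedding.ofStrictMono u (Finset.mem_filter.1 hu).2))
    (fun s _ => Set.powersetCard.ofFinEmbEquiv.symm s) (fun _ _ => Finset.mem_univ _)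
    (fun s _ => ?_) (fun u hu => ?_) (fun s _ => ?_) (fun u hu => ?_)
  · simpa using (Set.powersetCard.ofFinEmbEquiv.symm s).strictMono
  · simp
  · exact Set.powersetCard.ofFinEmbEquiv.symm.injective (by ext; simp)
  · rw [exteriorPower.basis_repr_apply, exteriorPower.ιMultiDual_apply_ιMulti,
      exteriorPower.basis_apply, exteriorPower.ιMulti_family_apply_coe,
      ExteriorAlgebra.ιMulti_family, basisVector, Equiv.symm_apply_apply]
    congr 2
    ext k
    simp

/-- The `L`-vector of a confluent block: the wedge product of the first `L` divided derivatives at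
`x` of the moment curve in `ℂ ^ N`. -/
def confluentWedge (N L : ℕ) (x : ℂ) : Ext N :=
  ExteriorAlgebra.ιMulti ℂ L fun l : Fin L => confluentVector N x l

/-- The size `∑ k, (u k - k)` of the partition with parts `u k - k`, for strictly increasing `u`:
the exponent of `x` in the coefficient of `e_u` in `confluentWedge`. -/
def partitionSize {N L : ℕ} (u : Fin L → Fin N) : ℤ :=
  ∑ k, ((u k : ℤ) - (k : ℤ))

theorem zpow_sum {ι G : Type*} [CommGroupWithZero G] {x : G} (hx : x ≠ 0) (s : Finset ι)
    (n : ι → ℤ) : x ^ (∑ i ∈ s, n i) = ∏ i ∈ s, x ^ n i := by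
  classical
  induction s using Finset.induction_on with
  | empty => simp
  | insert a s ha ih => rw [Finset.sum_insert ha, Finset.prod_insert ha, zpow_add₀ hx, ih]

theorem det_confluentVector {N L : ℕ} {x : ℂ} (hx : x ≠ 0) (u : Fin L → Fin N) :
    (Matrix.of fun i k : Fin L => confluentVector N x i (u k)).det =
      x ^ partitionSize u * normVandermonde u := by
  have transpose_eq : (Matrix.of fun i k : Fin L => confluentVector N x i (u k)).transpose =
      Matrix.of fun k l : Fin L => x ^ (u k : ℤ) * (Matrix.of fun k l : Fin L =>
        x ^ (-(l : ℤ)) * (Matrix.of fun k l : Fin L => ((u k : ℕ).choose l : ℂ)) k l) k l := by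
    ext k l
    simp only [Matrix.transpose_apply, Matrix.of_apply, confluentVector]
    rcases le_or_gt (l : ℕ) (u k) with hle | hlt
    · rw [← zpow_natCast x (_ - _), Nat.cast_sub hle, sub_eq_add_neg, zpow_add₀ hx]
      ring
    · simp [Nat.choose_eq_zero_of_lt hlt]
  rw [← Matrix.det_transpose, transpose_eq, Matrix.det_mul_column, Matrix.det_mul_row,
    det_choose_eq_normVandermonde, ← mul_assoc, partitionSize, zpow_sum hx]
  simp only [← Finset.prod_mul_distrib, sub_eq_add_neg, zpow_add₀ hx]

open Classical in
theorem confluentWedge_eq_sum (N L : ℕ) {x : ℂ} (hx : x ≠ 0) :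
    confluentWedge N L x = ∑ u : Fin L → Fin N with StrictMono u,
      (x ^ partitionSize u * normVandermonde u) • basisVector u := by
  simp_rw [confluentWedge, ιMulti_eq_sum_det_smul_basisVector, det_confluentVector hx]

theorem prod_ofFn_confluentWedge {L K : ℕ} (x : Fin K → ℂ) :
    (List.ofFn fun i => confluentWedge (L * K) L (x i)).prod =
      ExteriorAlgebra.ιMulti ℂ (L * K) (confluentVandermonde L x).row := by
  have row_eq (i : Fin K) (l : Fin L) (h : L * i + l < L * K) :
      (confluentVandermonde L x).row ⟨L * i + l, h⟩ = confluentVector (L * K) (x i) l := by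
    have block_eq : blockIndex (⟨L * i + l, h⟩ : Fin (L * K)) = i := by
      ext
      simp [blockIndex, Nat.mul_add_div l.pos, Nat.div_eq_of_lt l.2]
    ext n
    simp [confluentVandermonde, block_eq, Nat.mod_eq_of_lt l.2]
  rw [ExteriorAlgebra.ιMulti_apply, List.ofFn_mul', List.prod_flatten, List.map_ofFn]
  simp only [confluentWedge, ExteriorAlgebra.ιMulti_apply, Function.comp_def, row_eq]

theorem volumeCoeff_ιMulti {N : ℕ} (v : Fin N → Fin N → ℂ) :
    volumeCoeff N (ExteriorAlgebra.ιMulti ℂ N v) = (Matrix.of v).det := by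
  rw [volumeCoeff, ExteriorAlgebra.liftAlternating_apply_ιMulti, Pi.single_eq_same]
  rfl

theorem volumeCoeff_prod_ofFn_confluentWedge {L K : ℕ} (x : Fin K → ℂ) :
    volumeCoeff (L * K) (List.ofFn fun i => confluentWedge (L * K) L (x i)).prod =
      ∏ i, ∏ j ∈ Finset.Ioi i, (x j - x i) ^ (L ^ 2) := by
  rw [prod_ofFn_confluentWedge, volumeCoeff_ιMulti, ← det_confluentVandermonde]
  rfl

/-! ### Laurent polynomials evaluated at `ε` -/

/-- The multivector `p(ε) = ∑ j, b_j ε^j` of a Laurent polynomial `p = ∑ j, b_j x^j`. -/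
def evalEpsilon (N L : ℕ) (p : LaurentPolynomial ℂ) : Ext N :=
  p.coeff.sum fun j b => b • epsilon N L j

theorem support_coeff_fPow_subset {β : ℕ} (hβ : Even β) {m : ℕ} (y : Fin m → Circle) :
    (fPow β y).coeff.support ⊆
      Finset.Icc (-((β / 2 * m : ℕ) : ℤ)) ((β / 2 * m : ℕ) : ℤ) := by
  let q : Polynomial ℂ := ∏ n, (Polynomial.X - Polynomial.C (y n : ℂ)) ^ β
  have natDegree_q : q.natDegree = β * m := by
    rw [Polynomial.natDegree_prod_of_monic _ _ fun n _ => (Polynomial.monic_X_sub_C _).pow _]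
    simp [(Polynomial.monic_X_sub_C _).natDegree_pow, mul_comm]
  have fPow_eq : fPow β y =
      LaurentPolynomial.T (-((β / 2 * m : ℕ) : ℤ)) * Polynomial.toLaurent q := by
    simp [fPow, q, Polynomial.toLaurent_X, Polynomial.toLaurent_C]
  intro j hj
  rw [Finsupp.mem_support_iff, fPow_eq, coeff_T_mul, ← Finsupp.mem_support_iff,
    LaurentPolynomial.support_coeff_toLaurent, Finset.mem_map] at hj
  obtain ⟨i, hi, hij⟩ := hj
  have shift : (i : ℤ) = j - -((β / 2 * m : ℕ) : ℤ) := hij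
  have i_le := Polynomial.le_natDegree_of_mem_supp i hi
  have twice_half : β * m = β / 2 * m + β / 2 * m := by
    rw [← two_mul, ← mul_assoc, Nat.mul_div_cancel' hβ.two_dvd]
  rw [Finset.mem_Icc]
  omega

theorem fPowEpsilon_eq_evalEpsilon {β : ℕ} (hβ : Even β) (N L : ℕ) {m : ℕ} (y : Fin m → Circle) :
    fPowEpsilon β N L y = evalEpsilon N L (fPow β y) :=
  (Finsupp.sum_of_support_subset _ (support_coeff_fPow_subset hβ y)
    (fun j b => b • epsilon N L j) fun j _ => zero_smul ℂ (epsilon N L j)).symm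

open Classical in
theorem evalEpsilon_eq_sum {N L : ℕ} {d : (Fin L → Fin N) → ℤ} (hd : ∀ u, excess u = d u)
    (p : LaurentPolynomial ℂ) :
    evalEpsilon N L p = ∑ u : Fin L → Fin N with StrictMono u,
      (p.coeff (d u) * normVandermonde u) • basisVector u := by
  simp only [evalEpsilon, Finsupp.sum, epsilon, hd, Int.cast_inj, ← Finset.filter_filter,
    Finset.smul_sum, Finset.sum_filter (fun u => d u = _)]
  rw [Finset.sum_comm]
  refine Finset.sum_congr rfl fun u _ => ?_
  simp only [smul_ite, smul_zero, Finset.sum_ite_eq, smul_smul]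
  split_ifs with hu
  · rfl
  · rw [Finsupp.notMem_support_iff.1 hu, zero_mul, zero_smul]

theorem excess_eq_partitionSize_sub {L : ℕ} (hL : Even L) {K : ℕ} (u : Fin L → Fin (L * K)) :
    excess u = ((partitionSize u - (L ^ 2 / 2 : ℕ) * ((K : ℤ) - 1) : ℤ) : ℚ) := by
  have half : ((L ^ 2 / 2 : ℕ) : ℚ) = (L : ℚ) ^ 2 / 2 := by
    rw [Nat.cast_div (hL.pow_of_ne_zero two_ne_zero).two_dvd two_ne_zero]
    push_cast
    rfl
  have sum_index : ∑ l : Fin L, ((l : ℕ) : ℚ) = L * (L - 1) / 2 := by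
    rw [Fin.sum_univ_eq_sum_range fun l => (l : ℚ), ← Nat.cast_sum, Finset.sum_range_id,
      ← Nat.choose_two_right, Nat.cast_choose_two]
  simp only [excess, partitionSize, Int.cast_sub, Int.cast_mul, Int.cast_sum, Int.cast_natCast,
    Int.cast_one, half, Finset.sum_sub_distrib, sum_index]
  push_cast
  ring

/-! ### The integral of de Bruijn's type -/

theorem integral_multilinearMap_sum_smul {ι U 𝕜 F : Type*} {X E : ι → Type*} [Fintype ι]
    [RCLike 𝕜] [NormedAddCommGroup F] [NormedSpace ℝ F] [NormedSpace 𝕜 F] [CompleteSpace F]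
    [∀ i, AddCommGroup (E i)] [∀ i, Module 𝕜 (E i)] [∀ i, MeasurableSpace (X i)]
    (μ : ∀ i, Measure (X i)) [∀ i, SigmaFinite (μ i)] (Φ : MultilinearMap 𝕜 E F)
    (s : ι → Finset U) {c : ∀ i, U → X i → 𝕜} (hc : ∀ i, ∀ u ∈ s i, Integrable (c i u) (μ i))
    (e : ∀ i, U → E i) :
    ∫ x, Φ (fun i => ∑ u ∈ s i, c i u (x i) • e i u) ∂Measure.pi μ =
      Φ fun i => ∑ u ∈ s i, (∫ z, c i u z ∂μ i) • e i u := by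
  classical
  simp_rw [MultilinearMap.map_sum_finset, MultilinearMap.map_smul_univ]
  rw [integral_finsetSum]
  · refine Finset.sum_congr rfl fun r _ => ?_
    rw [integral_smul_const, integral_fintype_prod_eq_prod fun i => c i (r i)]
  · intro r hr
    exact (Integrable.fintype_prod_dep fun i => hc i _ (Fintype.mem_piFinset.1 hr i)).smul_const _

/-- The `L`-vector that a particle at `z` with weight `p` contributes to the integrand. The
confluent block is evaluated at `z⁻¹` because the coefficient of `x^j` in `p` is the integral of
`z^(-j) * p(z)`. -/
def particleVector (L K : ℕ) (p : LaurentPolynomial ℂ) (z : Circle) : Ext (L * K) :=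
  (laurentEval z p * (z : ℂ) ^ ((L ^ 2 / 2 : ℕ) * ((K : ℤ) - 1))) •
    confluentWedge (L * K) L (z : ℂ)⁻¹

open Classical in
theorem particleVector_eq_sum (L K : ℕ) (p : LaurentPolynomial ℂ) (z : Circle) :
    particleVector L K p z = ∑ u : Fin L → Fin (L * K) with StrictMono u,
      ((z : ℂ) ^ (-(partitionSize u - (L ^ 2 / 2 : ℕ) * ((K : ℤ) - 1))) * laurentEval z p *
        normVandermonde u) • basisVector u := by
  have hz := Circle.coe_ne_zero z
  rw [particleVector, confluentWedge_eq_sum _ _ (inv_ne_zero hz), Finset.smul_sum]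
  refine Finset.sum_congr rfl fun u _ => ?_
  rw [smul_smul, neg_sub, sub_eq_add_neg _ (partitionSize u), zpow_add₀ hz, inv_zpow, zpow_neg]
  ring_nf

theorem absVandermonde_mul_prod_laurentEval {L : ℕ} (hL : Even L) {K : ℕ}
    (p : LaurentPolynomial ℂ) (x : Fin K → Circle) :
    (absVandermonde (L ^ 2) x : ℂ) * ∏ i, laurentEval (x i) p =
      volumeCoeff (L * K) (List.ofFn fun i => particleVector L K p (x i)).prod := by
  have hL4 : 4 ∣ L ^ 2 := pow_dvd_pow_of_dvd hL.two_dvd 2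
  have monomial_eq (z : ℂ) :
      ((z⁻¹ ^ (L ^ 2 / 2))⁻¹) ^ ((K : ℤ) - 1) = z ^ ((L ^ 2 / 2 : ℕ) * ((K : ℤ) - 1)) := by
    rw [inv_pow, inv_inv, zpow_mul, zpow_natCast]
  rw [← absVandermonde_inv, absVandermonde_eq_prod_sub_pow hL4]
  simp only [Pi.inv_apply, Circle.coe_inv, monomial_eq]
  rw [← volumeCoeff_prod_ofFn_confluentWedge]
  simp only [particleVector, ← MultilinearMap.mkPiAlgebraFin_apply (R := ℂ)]
  rw [MultilinearMap.map_smul_univ, map_smul, smul_eq_mul, Finset.prod_mul_distrib]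
  ring

theorem integral_absVandermonde_mul_prod_laurentEval {L : ℕ} (hL : Even L) (K : ℕ)
    (p : LaurentPolynomial ℂ) :
    ∫ x : Fin K → Circle, (absVandermonde (L ^ 2) x : ℂ) * ∏ i, laurentEval (x i) p
        ∂haarTorus K =
      volumeCoeff (L * K) (evalEpsilon (L * K) L p ^ K) := by
  classical
  simp_rw [absVandermonde_mul_prod_laurentEval hL, particleVector_eq_sum]
  have fubini := integral_multilinearMap_sum_smul (fun _ : Fin K => haarCircle)
    ((volumeCoeff (L * K)).compMultilinearMap (MultilinearMap.mkPiAlgebraFin ℂ K (Ext (L * K))))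
    (fun _ => Finset.univ.filter fun u : Fin L → Fin (L * K) => StrictMono u)
    (c := fun _ u z => (z : ℂ) ^ (-(partitionSize u - (L ^ 2 / 2 : ℕ) * ((K : ℤ) - 1))) *
      laurentEval z p * normVandermonde u)
    (fun _ u _ => integrable_of_continuous
      (((continuous_coe_zpow _).mul (continuous_laurentEval p)).mul continuous_const))
    (fun _ => basisVector)
  simp_rw [integral_mul_const, integral_zpow_mul_laurentEval] at fubini
  rw [← evalEpsilon_eq_sum (excess_eq_partitionSize_sub hL)] at fubini
  simpa only [haarTorus, LinearMap.compMultilinearMap_apply, MultilinearMap.mkPiAlgebraFin_apply,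
    List.ofFn_const, List.prod_replicate] using fubini

/-! ### Correlation functions of exchangeable particles -/

section

variable (β : ℕ) {M : ℕ}

theorem continuous_jointDensity : Continuous fun x : Fin M → Circle => jointDensity β x :=
  (continuous_absVandermonde β).const_mul _

theorem jointDensity_nonneg (x : Fin M → Circle) : 0 ≤ jointDensity β x := by
  have partitionFunction_nonneg : 0 ≤ partitionFunction β M :=
    mul_nonneg (by positivity) (integral_nonneg fun x => absVandermonde_nonneg β x)
  exact mul_nonneg (by positivity) (absVandermonde_nonneg β x)

theorem jointDensity_comp_perm (x : Fin M → Circle) (σ : Equiv.Perm (Fin M)) :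
    jointDensity β (x ∘ σ) = jointDensity β x := by
  rw [jointDensity, jointDensity, absVandermonde_comp_perm]

end

theorem measurePreserving_comp_perm {M : ℕ} (σ : Equiv.Perm (Fin M)) :
    MeasurePreserving (fun x : Fin M → Circle => x ∘ σ) (haarTorus M) (haarTorus M) := by
  simp only [haarTorus]
  convert measurePreserving_piCongrLeft (fun _ : Fin M => haarCircle) σ.symm using 1
  refine funext fun x => funext fun i => ?_
  simpa [MeasurableEquiv.coe_piCongrLeft] using
    (Equiv.piCongrLeft_apply_apply (P := fun _ => Circle) σ.symm x (σ i)).symm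

theorem measurePreserving_concat {m M : ℕ} (h : m ≤ M) :
    MeasurePreserving (fun p : (Fin m → Circle) × (Fin (M - m) → Circle) => concat h p.1 p.2)
      ((haarTorus m).prod (haarTorus (M - m))) (haarTorus M) := by
  let e : Fin m ⊕ Fin (M - m) ≃ Fin M := finSumFinEquiv.trans (finCongr (Nat.add_sub_of_le h))
  simp only [haarTorus]
  convert (measurePreserving_piCongrLeft (fun _ : Fin M => haarCircle) e).comp
    (measurePreserving_sumPiEquivProdPi_symm fun _ : Fin m ⊕ Fin (M - m) => haarCircle) using 1
  ext p i
  obtain ⟨i, rfl⟩ := e.surjective i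
  rw [Function.comp_apply, MeasurableEquiv.coe_piCongrLeft,
    Equiv.piCongrLeft_apply_apply (P := fun _ => Circle)]
  rcases i with i | i <;> simp [e, concat, MeasurableEquiv.sumPiEquivProdPi]

theorem concat_castLE {m M : ℕ} (h : m ≤ M) (y : Fin m → Circle) (x : Fin (M - m) → Circle)
    (i : Fin m) : concat h y x (Fin.castLE h i) = y i :=
  Fin.append_left y x i

theorem exists_perm_castLE_eq {m M : ℕ} (h : m ≤ M) (φ : Fin m ↪ Fin M) :
    ∃ σ : Equiv.Perm (Fin M), ∀ i, σ (Fin.castLE h i) = φ i := by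
  have := Equiv.Perm.isMultiplyPretransitive (Fin M) m
  obtain ⟨σ, hσ⟩ := MulAction.exists_smul_eq (Equiv.Perm (Fin M)) (Fin.castLEEmb h) φ
  exact ⟨σ, DFunLike.congr_fun hσ⟩

theorem lintegral_mul_comp_embedding {m M : ℕ} (h : m ≤ M) {ρ : (Fin M → Circle) → ENNReal}
    (hρ : Measurable ρ) (hρσ : ∀ x (σ : Equiv.Perm (Fin M)), ρ (x ∘ σ) = ρ x)
    {g : (Fin m → Circle) → ENNReal} (hg : Measurable g) (φ : Fin m ↪ Fin M) :
    ∫⁻ x, ρ x * g (x ∘ φ) ∂haarTorus M =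
      ∫⁻ y, g y * ∫⁻ x, ρ (concat h y x) ∂haarTorus (M - m) ∂haarTorus m := by
  have hmeas : Measurable fun x : Fin M → Circle => ρ x * g (x ∘ Fin.castLE h) := by fun_prop
  obtain ⟨σ, hσ⟩ := exists_perm_castLE_eq h φ
  have comp_eq (x : Fin M → Circle) : (x ∘ σ) ∘ Fin.castLE h = x ∘ φ :=
    funext fun i => congrArg x (hσ i)
  have concat_comp (y : Fin m → Circle) (x : Fin (M - m) → Circle) :
      concat h y x ∘ Fin.castLE h = y :=
    funext (concat_castLE h y x)
  calc ∫⁻ x, ρ x * g (x ∘ φ) ∂haarTorus M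
      = ∫⁻ x, ρ (x ∘ σ) * g ((x ∘ σ) ∘ Fin.castLE h) ∂haarTorus M := by
        simp_rw [hρσ, comp_eq]
    _ = ∫⁻ x, ρ x * g (x ∘ Fin.castLE h) ∂haarTorus M :=
        (measurePreserving_comp_perm σ).lintegral_comp hmeas
    _ = ∫⁻ p, ρ (concat h p.1 p.2) * g (concat h p.1 p.2 ∘ Fin.castLE h)
          ∂(haarTorus m).prod (haarTorus (M - m)) :=
        ((measurePreserving_concat h).lintegral_comp hmeas).symm
    _ = ∫⁻ y, ∫⁻ x, ρ (concat h y x) * g (concat h y x ∘ Fin.castLE h)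
          ∂haarTorus (M - m) ∂haarTorus m :=
        lintegral_prod _ (hmeas.comp (measurePreserving_concat h).measurable).aemeasurable
    _ = ∫⁻ y, g y * ∫⁻ x, ρ (concat h y x) ∂haarTorus (M - m) ∂haarTorus m := by
        refine lintegral_congr fun y => ?_
        have hρy : Measurable fun x => ρ (concat h y x) :=
          (hρ.comp (measurePreserving_concat h).measurable).comp measurable_prodMk_left
        simp_rw [concat_comp, lintegral_mul_const _ hρy, mul_comm]

theorem occupation_eq_sum_indicator {M : ℕ} (B : Set Circle) (x : Fin M → Circle) :
    (occupation B x : ENNReal) = ∑ k, B.indicator 1 (x k) := by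
  classical
  rw [occupation, Set.ncard_eq_toFinset_card', Finset.card_eq_sum_ones, Nat.cast_sum,
    Set.toFinset_ofPred, Finset.sum_filter]
  exact Finset.sum_congr rfl fun k _ => by simp [Set.indicator_apply]

theorem indicator_univ_pi_eq_prod {ι X : Type*} [Fintype ι] (B : ι → Set X) (y : ι → X) :
    (Set.univ.pi B).indicator (1 : (ι → X) → ENNReal) y = ∏ i, (B i).indicator 1 (y i) := by
  simpa using Set.indicator_pi_one_apply Finset.univ B y

theorem prod_occupation_eq_sum {m M : ℕ} {B : Fin m → Set Circle}
    (hB : Pairwise fun i j => Disjoint (B i) (B j)) (x : Fin M → Circle) :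
    ∏ i, (occupation (B i) x : ENNReal) =
      ∑ φ : Fin m ↪ Fin M, (Set.univ.pi B).indicator 1 (x ∘ φ) := by
  classical
  simp_rw [occupation_eq_sum_indicator, indicator_univ_pi_eq_prod]
  rw [Finset.prod_univ_sum, Fintype.piFinset_univ]
  symm
  refine Finset.sum_of_injOn (fun φ : Fin m ↪ Fin M => ⇑φ) DFunLike.coe_injective.injOn
    (by simp [Set.MapsTo]) ?_ (fun _ _ => rfl)
  intro φ _ hφ
  refine (indicator_univ_pi_eq_prod B (x ∘ φ)).symm.trans
    (Set.indicator_of_notMem (fun hx => hφ ?_) _)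
  have φ_injective : Function.Injective φ := fun i j hij => by
    by_contra hne
    exact Set.disjoint_left.1 (hB hne) (hx i trivial) (by simpa [hij] using hx j trivial)
  exact ⟨⟨φ, φ_injective⟩, by simp, rfl⟩

theorem ofReal_correlation (β : ℕ) {m M : ℕ} (h : m ≤ M) (y : Fin m → Circle) :
    ENNReal.ofReal (correlation β h y) = (M.descFactorial m : ENNReal) *
      ∫⁻ x, ENNReal.ofReal (jointDensity β (concat h y x)) ∂haarTorus (M - m) := by
  have integrable_density : Integrable (fun x => jointDensity β (concat h y x))
      (haarTorus (M - m)) := by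
    simp_rw [jointDensity, absVandermonde_concat]
    refine integrable_of_continuous ?_
    have := continuous_absVandermonde β (M := M - m)
    fun_prop
  have factorial_div : (M.factorial : ℝ) / ((M - m).factorial : ℝ) = M.descFactorial m := by
    rw [div_eq_iff (by exact_mod_cast Nat.factorial_ne_zero _), ← Nat.factorial_mul_descFactorial h,
      Nat.cast_mul, mul_comm]
  rw [correlation, factorial_div, ENNReal.ofReal_mul (by positivity), ENNReal.ofReal_natCast,
    ofReal_integral_eq_lintegral_ofReal integrable_density
      (ae_of_all _ fun x => jointDensity_nonneg β _)]

theorem measurable_correlation (β : ℕ) {m M : ℕ} (h : m ≤ M) :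
    Measurable (correlation β h) := by
  have hmeas : StronglyMeasurable fun p : (Fin m → Circle) × (Fin (M - m) → Circle) =>
      jointDensity β (concat h p.1 p.2) :=
    ((continuous_jointDensity β).measurable.comp
      (measurePreserving_concat h).measurable).stronglyMeasurable
  exact hmeas.integral_prod_right.measurable.const_mul _

theorem lintegral_prod_occupation_law (β : ℕ) {m M : ℕ} (h : m ≤ M) {B : Fin m → Set Circle}
    (hB : ∀ i, MeasurableSet (B i)) (hdisj : Pairwise fun i j => Disjoint (B i) (B j)) :
    ∫⁻ x, ∏ i, (occupation (B i) x : ENNReal) ∂law β M =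
      ∫⁻ y in Set.univ.pi B, ENNReal.ofReal (correlation β h y) ∂haarTorus m := by
  let ρ (x : Fin M → Circle) : ENNReal := ENNReal.ofReal (jointDensity β x)
  let g : (Fin m → Circle) → ENNReal := (Set.univ.pi B).indicator 1
  have hρ : Measurable ρ := (continuous_jointDensity β).measurable.ennreal_ofReal
  have hg : Measurable g := measurable_one.indicator (MeasurableSet.univ_pi hB)
  have hρσ (x : Fin M → Circle) (σ : Equiv.Perm (Fin M)) : ρ (x ∘ σ) = ρ x := by
    simp only [ρ, jointDensity_comp_perm]
  have hgφ (φ : Fin m ↪ Fin M) : Measurable fun x : Fin M → Circle => g (x ∘ φ) := by fun_prop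
  have hρg (φ : Fin m ↪ Fin M) : Measurable fun x : Fin M → Circle => ρ x * g (x ∘ φ) :=
    hρ.mul (hgφ φ)
  calc ∫⁻ x, ∏ i, (occupation (B i) x : ENNReal) ∂law β M
      = ∫⁻ x, ∑ φ : Fin m ↪ Fin M, ρ x * g (x ∘ φ) ∂haarTorus M := by
        simp_rw [prod_occupation_eq_sum hdisj, ← Finset.mul_sum]
        exact lintegral_withDensity_eq_lintegral_mul _ hρ
          (Finset.measurable_sum _ fun φ _ => hgφ φ)
    _ = M.descFactorial m *
          ∫⁻ y, g y * ∫⁻ x, ρ (concat h y x) ∂haarTorus (M - m) ∂haarTorus m := by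
        rw [lintegral_finsetSum _ fun φ _ => hρg φ]
        simp_rw [lintegral_mul_comp_embedding h hρ hρσ hg]
        simp [Fintype.card_embedding_eq]
    _ = ∫⁻ y in Set.univ.pi B, ENNReal.ofReal (correlation β h y) ∂haarTorus m := by
        rw [← lintegral_const_mul' _ _ (ENNReal.natCast_ne_top _),
          ← lintegral_indicator (MeasurableSet.univ_pi hB)]
        refine lintegral_congr fun y => ?_
        by_cases hy : y ∈ Set.univ.pi B <;> simp [hy, ofReal_correlation, g, ρ]

theorem isCorrelationFunction_correlation (β : ℕ) {m M : ℕ} (h : m ≤ M) :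
    IsCorrelationFunction (law β M) m (correlation β h) where
  nonneg _ := mul_nonneg (by positivity) (integral_nonneg fun _ => jointDensity_nonneg β _)
  measurable := measurable_correlation β h
  expectation_eq _ hB hdisj := lintegral_prod_occupation_law β h hB hdisj

/-! ### The hyperpfaffian formula -/

theorem laurentEval_fPow (β : ℕ) {m : ℕ} (y : Fin m → Circle) (z : Circle) :
    laurentEval z (fPow β y) = ((z : ℂ) ^ (β / 2 * m))⁻¹ * ∏ n, ((z : ℂ) - y n) ^ β := by
  simp only [fPow, map_mul, map_prod, map_pow, map_sub, laurentEval_T, laurentEval_C, zpow_one,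
    zpow_neg, zpow_natCast]

theorem prod_norm_coe_sub_coe_pow {β : ℕ} (hβ : 4 ∣ β) {m : ℕ} (y : Fin m → Circle) (z : Circle) :
    ((∏ n, ‖(z : ℂ) - y n‖ ^ β : ℝ) : ℂ) =
      (∏ n, ((y n : ℂ) ^ (β / 2))⁻¹) * laurentEval z (fPow β y) := by
  simp_rw [Complex.ofReal_prod, norm_coe_sub_coe_pow hβ, Finset.prod_mul_distrib, laurentEval_fPow]
  rw [Finset.prod_const, Finset.card_univ, Fintype.card_fin, inv_pow, ← pow_mul]
  ring

theorem absVandermonde_concat_eq_mul_prod_laurentEval {β : ℕ} (hβ : 4 ∣ β) {m M : ℕ} (h : m ≤ M)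
    (y : Fin m → Circle) (x : Fin (M - m) → Circle) :
    (absVandermonde β (concat h y x) : ℂ) =
      absVandermonde β y * (∏ n, (y n : ℂ) ^ (-((β / 2 * (M - m) : ℕ) : ℤ))) *
        (absVandermonde β x * ∏ i, laurentEval (x i) (fPow β y)) := by
  rw [absVandermonde_concat, Complex.ofReal_mul, Complex.ofReal_mul,
    Complex.ofReal_prod Finset.univ fun i => ∏ n, ‖(x i : ℂ) - y n‖ ^ β]
  simp_rw [prod_norm_coe_sub_coe_pow hβ, Finset.prod_mul_distrib, Finset.prod_const,
    Finset.card_univ, Fintype.card_fin, ← Finset.prod_pow, zpow_neg, zpow_natCast, pow_mul, inv_pow]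
  ring

theorem correlation_eq_hyperpfaffian {L : ℕ} (hL : Even L) {M m : ℕ} (hmM : m ≤ M)
    (y : Fin m → Circle) :
    (correlation (L ^ 2) hmM y : ℂ) =
      (M.factorial : ℂ) * ((Nat.multinomial Finset.univ fun _ : Fin M => L ^ 2 / 2 : ℕ) : ℂ)⁻¹ *
        (absVandermonde (L ^ 2) y : ℂ) *
        (∏ n, (y n : ℂ) ^ (-((L ^ 2 / 2 * (M - m) : ℕ) : ℤ))) *
        hyperpfaffian L (M - m) (fPowEpsilon (L ^ 2) (L * (M - m)) L y) := by
  have hβ : Even (L ^ 2) := hL.pow_of_ne_zero two_ne_zero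
  have hβ4 : 4 ∣ L ^ 2 := pow_dvd_pow_of_dvd hL.two_dvd 2
  simp_rw [correlation, jointDensity, factorial_mul_partitionFunction hβ]
  rw [integral_const_mul, Complex.ofReal_mul, Complex.ofReal_mul, ← integral_complex_ofReal]
  simp_rw [absVandermonde_concat_eq_mul_prod_laurentEval hβ4]
  rw [integral_const_mul, integral_absVandermonde_mul_prod_laurentEval hL, hyperpfaffian,
    fPowEpsilon_eq_evalEpsilon hβ, map_smul, smul_eq_mul]
  push_cast
  ring

end CircularEnsemble

end

theorem mainTheorem3 (L M m : ℕ) (hL : Even L) (hL0 : 0 < L) (hm : 1 ≤ m) (hmM : m ≤ M) :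
    CircularEnsemble.IsCorrelationFunction (CircularEnsemble.law (L ^ 2) M) m
        (CircularEnsemble.correlation (L ^ 2) hmM) ∧
      ∀ y : Fin m → Circle,
        (CircularEnsemble.correlation (L ^ 2) hmM y : ℂ) =
          (M.factorial : ℂ) *
            ((Nat.multinomial Finset.univ fun _ : Fin M => L ^ 2 / 2 : ℕ) : ℂ)⁻¹ *
            (CircularEnsemble.absVandermonde (L ^ 2) y : ℂ) *
            (∏ n, (y n : ℂ) ^ (-((L ^ 2 / 2 * (M - m) : ℕ) : ℤ))) *
            CircularEnsemble.hyperpfaffian L (M - m)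
              (CircularEnsemble.fPowEpsilon (L ^ 2) (L * (M - m)) L y) :=
  ⟨CircularEnsemble.isCorrelationFunction_correlation (L ^ 2) hmM,
    CircularEnsemble.correlation_eq_hyperpfaffian hL hmM⟩
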